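/- Let $(M^{2n+s},\varphi,\xi_\alpha,\eta^\alpha,g)$, $\alpha=1,\dots,s$, be a $C$-manifold: $M$ is a smooth manifold of dimension $2n+s$ with a Riemannian metric $g$, a $(1,1)$-tensor field $\varphi$, vector fields $\xi_\alpha$ and $1$-forms $\eta^\alpha$ (all smooth) such that $$\varphi^2X=-X+\sum_\alpha\eta^\alpha(X)\xi_\alpha,\quad \eta^\alpha(\xi_\beta)=\delta^\alpha_\beta,\quad \varphi\xi_\alpha=0,\quad \eta^\alpha\circ\varphi=0,\quad \eta^\alpha(X)=g(X,\xi_\alpha),$$ $$g(\varphi X,\varphi Y)=g(X,Y)-\sum_\alpha\eta^\alpha(X)\eta^\alpha(Y),$$ the Nijenhuis tensor satisfies $N_\varphi=-2\sum_\alpha d\eta^\alpha\otimes\xi_\alpha$, and $d\Omega=0$, $d\eta^\alpha=0$, where $\Omega(X,Y)=g(X,\varphi Y)$. For $q\in\mathbb R$ put $F_q=q\,\Omega$. A smooth curve $\gamma$ is a magnetic curve for $F_q$ if $\nabla_{\gamma'}\gamma'=\Phi_q(\gamma')$, where $\nabla$ is the Levi-Civita connection and $g(\Phi_qX,Y)=F_q(X,Y)$;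 it is a normal magnetic curve if moreover it has unit speed. Let $I$ be a nonempty open interval. A unit-speed smooth curve $\gamma:I\to M$ is a Frenet curve of order $r\ge 1$ if there are smooth orthonormal fields $T=\gamma',v_2,\dots,v_r$ along $\gamma$ and positive functions $\kappa_1,\dots,\kappa_{r-1}$ with $\nabla_TT=\kappa_1v_2$, $\nabla_Tv_i=-\kappa_{i-1}v_{i-1}+\kappa_iv_{i+1}$ for $1<i<r$, and $\nabla_Tv_r=-\kappa_{r-1}v_{r-1}$ (for $r=1$: $\nabla_TT=0$); we put $\kappa_i=0$ for $i\ge r$. It is a circle if $r=2$ and $\kappa_1$ is constant. A $\varphi$-helix of order $r$ is a Frenet curve of order $r$ with constant curvatures such that, at each point, the space $\mathrm{sp}\{T,v_2,\dots,v_r\}$ if $r\ge3$, respectively $\mathrm{sp}\{T,\dots,v_r,\xi_1,\dots,\xi_s\}$ if $r\le 2$, is $\varphi$-invariant. We say that $\gamma$ has constant contact angles $\theta_1,\dots,\theta_s$ if $\eta^\alpha(T)=\cos\theta_\alpha$ along $\gamma$ for all $\alpha$, and that $\gamma$ is Legendre if $\eta^\alpha(T)=0$ along $\gamma$ for all $\alpha$.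 **Theorem.** Let $\gamma$ be a $\varphi$-helix of order $r\le3$ in a $C$-manifold. (i) If $\gamma$ has constant contact angles with $\sum_\alpha\cos^2\theta_\alpha=1$, then $\gamma$ is an integral curve of $\pm\sum_\alpha\cos\theta_\alpha\,\xi_\alpha$ (for one of the signs), and it is a normal magnetic curve for $F_q$ for every $q\in\mathbb R$. (ii) If $\gamma$ is Legendre, then it is a circle, and it is a normal magnetic curve for $F_{\kappa_1}$ or for $F_{-\kappa_1}$. (iii) If $r\ge 2$ and $\gamma$ has constant contact angles with $\sum_\alpha\cos^2\theta_\alpha=\dfrac{\kappa_2^2}{\kappa_1^2+\kappa_2^2}$, then it is a normal magnetic curve for $F_{\sqrt{\kappa_1^2+\kappa_2^2}}$ or for $F_{-\sqrt{\kappa_1^2+\kappa_2^2}}$. (iv) If none of the hypotheses of (i), (ii), (iii) holds, then $\gamma$ is not a magnetic curve for $F_q$, for any $q\in\mathbb R$. -/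

import Mathlib

open Bundle Set
open scoped Manifold ContDiff

noncomputable section

namespace CMfd

section Riemannian

variable {E : Type*} [NormedAddCommGroup E] [NormedSpace ℝ E]
variable {M : Type*} [TopologicalSpace M] [ChartedSpace E M] [IsManifold 𝓘(ℝ, E) ∞ M]

/-! ### Tensor fields in charts

For `p : M` the preferred chart is `extChartAt 𝓘(ℝ, E) p`, and on its domain the preferred
trivialization of the tangent bundle at `p` is the differential of this chart. All the objects below
do not depend on a chart, so at each point `p` they are computed in the chart at `p`. -/

/-- The differential at `x` of the chart at `p`. -/
def chartDiff (p x : M) : TangentSpace 𝓘(ℝ, E) x →L[ℝ] E :=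
  (trivializationAt E (TangentSpace 𝓘(ℝ, E)) p).continuousLinearMapAt ℝ x

/-- The inverse of the differential at `x` of the chart at `p`: it sends a coordinate vector to the
tangent vector at `x` with these coordinates. -/
def chartDiffSymm (p x : M) : E →L[ℝ] TangentSpace 𝓘(ℝ, E) x :=
  (trivializationAt E (TangentSpace 𝓘(ℝ, E)) p).symmL ℝ x

/-- The coordinate expression, in the chart at `p`, of a `1`-form. -/
def oneFormInChart (a : ∀ x : M, TangentSpace 𝓘(ℝ, E) x →L[ℝ] ℝ) (p : M) : E → E →L[ℝ] ℝ :=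
  fun y =>
    let x := (extChartAt 𝓘(ℝ, E) p).symm y
    (a x).comp (chartDiffSymm p x)

/-- The coordinate expression, in the chart at `p`, of a field of bilinear forms. -/
def bilinInChart
    (b : ∀ x : M, TangentSpace 𝓘(ℝ, E) x →L[ℝ] TangentSpace 𝓘(ℝ, E) x →L[ℝ] ℝ) (p : M) :
    E → E →L[ℝ] E →L[ℝ] ℝ :=
  fun y =>
    let x := (extChartAt 𝓘(ℝ, E) p).symm y
    (ContinuousLinearMap.precomp ℝ (chartDiffSymm p x)).comp ((b x).comp (chartDiffSymm p x))

/-- The coordinate expression, in the chart at `p`, of a `(1,1)`-tensor field. -/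
def endInChart (f : ∀ x : M, TangentSpace 𝓘(ℝ, E) x →L[ℝ] TangentSpace 𝓘(ℝ, E) x) (p : M) :
    E → E →L[ℝ] E :=
  fun y =>
    let x := (extChartAt 𝓘(ℝ, E) p).symm y
    (chartDiff p x).comp ((f x).comp (chartDiffSymm p x))

/-- The exterior derivative of a `1`-form, with the normalization
`2 da(X, Y) = X (a(Y)) - Y (a(X)) - a([X, Y])`. -/
def extDerivOneForm (a : ∀ x : M, TangentSpace 𝓘(ℝ, E) x →L[ℝ] ℝ) (p : M)
    (u v : TangentSpace 𝓘(ℝ, E) p) : ℝ :=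
  let D : E →L[ℝ] E →L[ℝ] ℝ := fderiv ℝ (oneFormInChart a p) (extChartAt 𝓘(ℝ, E) p p)
  let c := chartDiff p p
  (1 / 2) * (D (c u) (c v) - D (c v) (c u))

/-- The exterior derivative of a `2`-form, with the normalization
`3 db(X, Y, Z) = X (b(Y, Z)) + Y (b(Z, X)) + Z (b(X, Y))` for commuting fields `X, Y, Z`. -/
def extDerivTwoForm
    (b : ∀ x : M, TangentSpace 𝓘(ℝ, E) x →L[ℝ] TangentSpace 𝓘(ℝ, E) x →L[ℝ] ℝ) (p : M)
    (u v w : TangentSpace 𝓘(ℝ, E) p) : ℝ :=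
  let D : E → E → E → ℝ := fun x₁ x₂ x₃ =>
    fderiv ℝ (fun y => bilinInChart b p y x₂ x₃) (extChartAt 𝓘(ℝ, E) p p) x₁
  let c := chartDiff p p
  (1 / 3) * (D (c u) (c v) (c w) + D (c v) (c w) (c u) + D (c w) (c u) (c v))

/-- The Nijenhuis tensor of a `(1,1)`-tensor field `f`,
`N(X, Y) = f² [X, Y] + [f X, f Y] - f [f X, Y] - f [X, f Y]`,
computed at `p` with the fields `X, Y` which are constant in the chart at `p`. -/
def nijenhuis (f : ∀ x : M, TangentSpace 𝓘(ℝ, E) x →L[ℝ] TangentSpace 𝓘(ℝ, E) x) (p : M)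
    (u v : TangentSpace 𝓘(ℝ, E) p) : TangentSpace 𝓘(ℝ, E) p :=
  let A : E → E →L[ℝ] E := endInChart f p
  let y : E := extChartAt 𝓘(ℝ, E) p p
  let X : E → E := fun _ => chartDiff p p u
  let Y : E → E := fun _ => chartDiff p p v
  let AX : E → E := fun z => A z (X z)
  let AY : E → E := fun z => A z (Y z)
  chartDiffSymm p p
    (A y (A y (VectorField.lieBracket ℝ X Y y)) + VectorField.lieBracket ℝ AX AY y
      - A y (VectorField.lieBracket ℝ AX Y y) - A y (VectorField.lieBracket ℝ X AY y))

/-- A smooth Riemannian metric on `M`. -/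
abbrev Metric (E : Type*) [NormedAddCommGroup E] [NormedSpace ℝ E]
    (M : Type*) [TopologicalSpace M] [ChartedSpace E M] [IsManifold 𝓘(ℝ, E) ∞ M] :=
  ContMDiffRiemannianMetric 𝓘(ℝ, E) ∞ E (fun x : M => TangentSpace 𝓘(ℝ, E) x)

/-! ### The Levi-Civita connection along a curve -/

/-- The metric at `p`, as a bilinear form. -/
def Metric.bilin (g : Metric E M) (p : M) : LinearMap.BilinForm ℝ (TangentSpace 𝓘(ℝ, E) p) :=
  LinearMap.mk₂ ℝ (fun u v => g.inner p u v) (by simp) (by simp) (by simp) (by simp)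

theorem Metric.bilin_nondegenerate (g : Metric E M) (p : M) : (g.bilin p).Nondegenerate := by
  have key : ∀ v : TangentSpace 𝓘(ℝ, E) p, g.inner p v v = 0 → v = 0 := by
    intro v hv
    by_contra h
    exact (g.pos p v h).ne' hv
  exact ⟨fun v hv => key v (hv v), fun v hv => key v (hv v)⟩

/-- The tangent vector `v` at `p` with `g(v, w) = a(w)` for all `w`. -/
def Metric.sharp [FiniteDimensional ℝ E] (g : Metric E M) (p : M)
    (a : Module.Dual ℝ (TangentSpace 𝓘(ℝ, E) p)) : TangentSpace 𝓘(ℝ, E) p :=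
  haveI : FiniteDimensional ℝ (TangentSpace 𝓘(ℝ, E) p) := inferInstanceAs (FiniteDimensional ℝ E)
  (LinearMap.BilinForm.toDual (g.bilin p) (g.bilin_nondegenerate p)).symm a

/-- The Christoffel symbols of the first kind at `p`, in the chart at `p`:
`w ↦ (∂_u g(v, w) + ∂_v g(u, w) - ∂_w g(u, v)) / 2`. -/
def Metric.christoffelFirst (g : Metric E M) (p : M) (u v : E) : E →L[ℝ] ℝ :=
  let G : E → E →L[ℝ] E →L[ℝ] ℝ := bilinInChart g.inner p
  let y₀ : E := extChartAt 𝓘(ℝ, E) p p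
  (1 / 2 : ℝ) • (fderiv ℝ (fun y => G y v) y₀ u + fderiv ℝ (fun y => G y u) y₀ v
    - fderiv ℝ (fun y => G y u v) y₀)

/-- The Christoffel symbols (of the second kind) at `p` of the Levi-Civita connection, in the chart
at `p`, as a tangent vector at `p`. -/
def Metric.christoffel [FiniteDimensional ℝ E] (g : Metric E M) (p : M)
    (u v : TangentSpace 𝓘(ℝ, E) p) : TangentSpace 𝓘(ℝ, E) p :=
  g.sharp p (((g.christoffelFirst p (chartDiff p p u) (chartDiff p p v)).comp (chartDiff p p) :
    TangentSpace 𝓘(ℝ, E) p →L[ℝ] ℝ) : TangentSpace 𝓘(ℝ, E) p →ₗ[ℝ] ℝ)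

/-- The velocity `γ'(t)`. -/
def velocity (γ : ℝ → M) (t : ℝ) : TangentSpace 𝓘(ℝ, E) (γ t) :=
  mfderiv 𝓘(ℝ, ℝ) 𝓘(ℝ, E) γ t (1 : ℝ)

/-- Smoothness on `J` of a vector field along the curve `γ`. -/
def SmoothAlong (γ : ℝ → M) (J : Set ℝ) (V : ∀ t : ℝ, TangentSpace 𝓘(ℝ, E) (γ t)) : Prop :=
  ContMDiffOn 𝓘(ℝ, ℝ) 𝓘(ℝ, E).tangent ∞
    (fun t => (⟨γ t, V t⟩ : TangentBundle 𝓘(ℝ, E) M)) J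

/-- The covariant derivative `∇_{γ'} V` at time `t`, for the Levi-Civita connection of `g`, of a
vector field `V` along `γ`: in the chart at `γ t` it is `V' + Γ(γ', V)`. -/
def Metric.covDeriv [FiniteDimensional ℝ E] (g : Metric E M) (γ : ℝ → M)
    (V : ∀ t : ℝ, TangentSpace 𝓘(ℝ, E) (γ t)) (t : ℝ) : TangentSpace 𝓘(ℝ, E) (γ t) :=
  chartDiffSymm (γ t) (γ t) (deriv (fun τ : ℝ => chartDiff (γ t) (γ τ) (V τ)) t)
    + g.christoffel (γ t) (velocity γ t) (V t)

/-! ### Frenet curves and magnetic curves -/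

/-- `γ` is a (unit-speed, smooth) Frenet curve of osculating order `r` on `J`, with Frenet frame
`v 1 = γ', v 2, …, v r` and positive curvatures `κ 1, …, κ (r - 1)`. By convention the curvatures
`κ i` with `i ≥ r` are zero; the other values of `v` and `κ` play no role. -/
structure IsFrenetCurve [FiniteDimensional ℝ E] (g : Metric E M) (γ : ℝ → M) (J : Set ℝ) (r : ℕ)
    (v : ℕ → ∀ t : ℝ, TangentSpace 𝓘(ℝ, E) (γ t)) (κ : ℕ → ℝ → ℝ) : Prop where
  one_le : 1 ≤ r
  smooth : ContMDiffOn 𝓘(ℝ, ℝ) 𝓘(ℝ, E) ∞ γ J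
  frame_smooth : ∀ i, 1 ≤ i → i ≤ r → SmoothAlong γ J (v i)
  frame_one : ∀ t ∈ J, v 1 t = velocity γ t
  orthonormal : ∀ t ∈ J, ∀ i j, 1 ≤ i → i ≤ r → 1 ≤ j → j ≤ r →
    g.inner (γ t) (v i t) (v j t) = if i = j then 1 else 0
  curvature_pos : ∀ t ∈ J, ∀ i, 1 ≤ i → i < r → 0 < κ i t
  curvature_zero : ∀ t ∈ J, ∀ i, r ≤ i → κ i t = 0
  frenet : ∀ t ∈ J, ∀ i, 1 ≤ i → i ≤ r →
    g.covDeriv γ (v i) t =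
      (if 1 < i then -(κ (i - 1) t) • v (i - 1) t else 0)
        + (if i < r then κ i t • v (i + 1) t else 0)

/-- `γ` is a circle on `J` with curvature the positive constant `k`. -/
def IsCircle [FiniteDimensional ℝ E] (g : Metric E M) (γ : ℝ → M) (J : Set ℝ) (k : ℝ) : Prop :=
  0 < k ∧ ∃ v : ℕ → ∀ t : ℝ, TangentSpace 𝓘(ℝ, E) (γ t),
    IsFrenetCurve g γ J 2 v (fun i _ => if i = 1 then k else 0)

/-- The Lorentz force `Φ` of a `2`-form `F`, determined by `g(Φ X, Y) = F(X, Y)`. -/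
def lorentzForce [FiniteDimensional ℝ E] (g : Metric E M)
    (F : ∀ x : M, TangentSpace 𝓘(ℝ, E) x →L[ℝ] TangentSpace 𝓘(ℝ, E) x →L[ℝ] ℝ)
    (p : M) (u : TangentSpace 𝓘(ℝ, E) p) : TangentSpace 𝓘(ℝ, E) p :=
  g.sharp p (F p u : TangentSpace 𝓘(ℝ, E) p →ₗ[ℝ] ℝ)

/-- `γ` is a magnetic curve on `J` for `F`: a smooth solution of the Lorentz equation
`∇_{γ'} γ' = Φ(γ')`. -/
def IsMagneticCurve [FiniteDimensional ℝ E] (g : Metric E M)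
    (F : ∀ x : M, TangentSpace 𝓘(ℝ, E) x →L[ℝ] TangentSpace 𝓘(ℝ, E) x →L[ℝ] ℝ)
    (γ : ℝ → M) (J : Set ℝ) : Prop :=
  ContMDiffOn 𝓘(ℝ, ℝ) 𝓘(ℝ, E) ∞ γ J ∧
    ∀ t ∈ J, g.covDeriv γ (velocity γ) t = lorentzForce g F (γ t) (velocity γ t)

/-- A normal magnetic curve is a magnetic curve of unit speed. -/
def IsNormalMagneticCurve [FiniteDimensional ℝ E] (g : Metric E M)
    (F : ∀ x : M, TangentSpace 𝓘(ℝ, E) x →L[ℝ] TangentSpace 𝓘(ℝ, E) x →L[ℝ] ℝ)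
    (γ : ℝ → M) (J : Set ℝ) : Prop :=
  IsMagneticCurve g F γ J ∧ ∀ t ∈ J, g.inner (γ t) (velocity γ t) (velocity γ t) = 1

end Riemannian

/-! ### Framed `φ`-manifolds and `C`-manifolds -/

/-- A framed `φ`-structure `(φ, ξ_α, η^α, g)`, `α = 1, …, s`, on the manifold `M`. -/
structure FramedStructure (E : Type*) [NormedAddCommGroup E] [NormedSpace ℝ E]
    (M : Type*) [TopologicalSpace M] [ChartedSpace E M] [IsManifold 𝓘(ℝ, E) ∞ M] (s : ℕ) where
  /-- the metric -/
  g : Metric E M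
  /-- the `(1,1)`-tensor field -/
  φ : ∀ x : M, TangentSpace 𝓘(ℝ, E) x →L[ℝ] TangentSpace 𝓘(ℝ, E) x
  /-- the structure vector fields -/
  ξ : Fin s → ∀ x : M, TangentSpace 𝓘(ℝ, E) x
  /-- the structure `1`-forms -/
  η : Fin s → ∀ x : M, TangentSpace 𝓘(ℝ, E) x →L[ℝ] ℝ
  φ_smooth : ContMDiff 𝓘(ℝ, E) (𝓘(ℝ, E).prod 𝓘(ℝ, E →L[ℝ] E)) ∞
    (fun x => TotalSpace.mk' (E →L[ℝ] E)
      (E := fun x : M => TangentSpace 𝓘(ℝ, E) x →L[ℝ] TangentSpace 𝓘(ℝ, E) x) x (φ x))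
  ξ_smooth : ∀ α, ContMDiff 𝓘(ℝ, E) 𝓘(ℝ, E).tangent ∞
    (fun x => (⟨x, ξ α x⟩ : TangentBundle 𝓘(ℝ, E) M))
  η_smooth : ∀ α, ContMDiff 𝓘(ℝ, E) (𝓘(ℝ, E).prod 𝓘(ℝ, E →L[ℝ] ℝ)) ∞
    (fun x => TotalSpace.mk' (E →L[ℝ] ℝ)
      (E := fun x : M => TangentSpace 𝓘(ℝ, E) x →L[ℝ] ℝ) x (η α x))
  φ_φ : ∀ x u, φ x (φ x u) = -u + ∑ α, η α x u • ξ α x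
  η_ξ : ∀ x α β, η α x (ξ β x) = if α = β then 1 else 0
  φ_ξ : ∀ x α, φ x (ξ α x) = 0
  η_φ : ∀ x α u, η α x (φ x u) = 0
  η_eq : ∀ x α u, η α x u = g.inner x u (ξ α x)
  g_φ_φ : ∀ x u w, g.inner x (φ x u) (φ x w) = g.inner x u w - ∑ α, η α x u * η α x w

namespace FramedStructure

variable {E : Type*} [NormedAddCommGroup E] [NormedSpace ℝ E]
variable {M : Type*} [TopologicalSpace M] [ChartedSpace E M] [IsManifold 𝓘(ℝ, E) ∞ M] {s : ℕ}

/-- The fundamental `2`-form `Ω(X, Y) = g(X, φ Y)`. -/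
def Ω (S : FramedStructure E M s) (x : M) :
    TangentSpace 𝓘(ℝ, E) x →L[ℝ] TangentSpace 𝓘(ℝ, E) x →L[ℝ] ℝ :=
  (ContinuousLinearMap.precomp ℝ (S.φ x)).comp (S.g.inner x)

/-- The contact magnetic field `F_q = q Ω` of strength `q`. -/
def magneticField (S : FramedStructure E M s) (q : ℝ) (x : M) :
    TangentSpace 𝓘(ℝ, E) x →L[ℝ] TangentSpace 𝓘(ℝ, E) x →L[ℝ] ℝ :=
  q • S.Ω x

/-- A framed `φ`-manifold is a `C`-manifold if it is normal, i.e. `N_φ = -2 ∑ dη^α ⊗ ξ_α`, and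
`dΩ = 0` and `dη^α = 0` for all `α`. -/
structure IsCManifold (S : FramedStructure E M s) : Prop where
  normal : ∀ (p : M) (u v : TangentSpace 𝓘(ℝ, E) p),
    nijenhuis S.φ p u v = -(2 : ℝ) • ∑ α, extDerivOneForm (S.η α) p u v • S.ξ α p
  dΩ_eq_zero : ∀ (p : M) (u v w : TangentSpace 𝓘(ℝ, E) p), extDerivTwoForm S.Ω p u v w = 0
  dη_eq_zero : ∀ (α : Fin s) (p : M) (u v : TangentSpace 𝓘(ℝ, E) p),
    extDerivOneForm (S.η α) p u v = 0

/-- `γ` has the constant contact angles `θ_α` on `J`, that is `η^α(γ') = cos θ_α` (a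
`θ_α`-slant curve). -/
def HasContactAngles (S : FramedStructure E M s) (γ : ℝ → M) (J : Set ℝ) (θ : Fin s → ℝ) : Prop :=
  ∀ t ∈ J, ∀ α, S.η α (γ t) (velocity γ t) = Real.cos (θ α)

/-- `γ` is a Legendre curve on `J`: its velocity is orthogonal to all the `ξ_α`. -/
def IsLegendre (S : FramedStructure E M s) (γ : ℝ → M) (J : Set ℝ) : Prop :=
  ∀ t ∈ J, ∀ α, S.η α (γ t) (velocity γ t) = 0

/-- The space which has to be `φ`-invariant for a `φ`-curve with Frenet frame `v 1, …, v r`: the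
span of `v 1, …, v r` if `r ≥ 3`, and the span of `v 1, …, v r` and `ξ_1, …, ξ_s` if `r ≤ 2`. -/
def frameSpan (S : FramedStructure E M s) (γ : ℝ → M) (r : ℕ)
    (v : ℕ → ∀ t : ℝ, TangentSpace 𝓘(ℝ, E) (γ t)) (t : ℝ) :
    Submodule ℝ (TangentSpace 𝓘(ℝ, E) (γ t)) :=
  Submodule.span ℝ ((fun i => v i t) '' Icc 1 r) ⊔
    (if r ≤ 2 then Submodule.span ℝ (range fun α => S.ξ α (γ t)) else ⊥)

/-- `γ` is a `φ`-helix of order `r` on `J`, with Frenet frame `v` and constant curvatures `κ`. -/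
def IsPhiHelix [FiniteDimensional ℝ E] (S : FramedStructure E M s) (γ : ℝ → M) (J : Set ℝ) (r : ℕ)
    (v : ℕ → ∀ t : ℝ, TangentSpace 𝓘(ℝ, E) (γ t)) (κ : ℕ → ℝ) : Prop :=
  IsFrenetCurve S.g γ J r v (fun i _ => κ i) ∧
    ∀ t ∈ J, ∀ w ∈ S.frameSpan γ r v t, S.φ (γ t) w ∈ S.frameSpan γ r v t

end FramedStructure

end CMfd

end

/-!
On a `C`-manifold each structure field `ξ_α` is parallel, so along a curve
`d/dt η^α(V) = η^α(∇_{γ'} V)` for every vector field `V` (`FramedStructure.hasDerivAt_eta`). No other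
consequence of normality and of `dΩ = 0`, `dη^α = 0` is needed.

The parallelism is read off in a chart. Since `dη^α = 0`, it amounts to `ξ_α` being a Killing field
(`two_mul_fderiv_oneForm_eq_christoffel`). Now `N_φ(·, ξ_α) = 0` and `dη^β = 0` give `L_{ξ_α} φ = 0`;
`dη^β = 0` and the constancy of `η^β(ξ_α)` give `L_{ξ_α} η^β = 0`; `dΩ = 0` and `i_{ξ_α} Ω = 0` give
`L_{ξ_α} Ω = 0`; and the metric is a polynomial in these tensors,
`g(X, Y) = Ω(φ X, Y) + ∑ η^β(X) η^β(Y)`.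

The Lorentz force of `q Ω` is `-q φ`, so a Frenet curve is magnetic exactly if `∇_T T = -q φ T`. For a
`φ`-helix of order `1` the invariance of `sp{T, ξ_1, …, ξ_s}` forces `φ T = 0`, so `T` is a combination
of the `ξ_α` and `∑ η^α(T)² = 1`. For order `2` or `3` with constant `η^α(T)`, differentiating `η^α(T)`
and `η^α(v₂)` gives `η^α(v₂) = 0` and `κ₂ η^α(v₃) = κ₁ η^α(T)`. Together with the invariance of the
frame this determines `φ` on it: `φ T = ± κ₁ / √(κ₁² + κ₂²) v₂` and
`∑ η^α(T)² = κ₂² / (κ₁² + κ₂²)` (`FramedStructure.IsPhiHelix.phi_velocity`); the sign is constant by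
continuity. So a `φ`-helix with constant contact angles always falls under one of the first three
cases, and a magnetic curve has constant contact angles because `η^α(φ T) = 0`.
-/

namespace CMfd

open Filter Topology

/-! ### The structure fields are Killing, in coordinates -/

/-- The coordinate form of `∇ ξ_i = 0` on a `C`-manifold: `∂_u η(v)` is the Christoffel symbol of the
first kind `Γ(u, v; ξ)`. Here `G`, `A`, `ξ`, `η` are the coordinate expressions of the metric, of `φ`,
and of the structure fields and forms; `nij` says that `N_φ` vanishes on the constant fields `u`, `v`. -/
theorem two_mul_fderiv_oneForm_eq_christoffel {E ι : Type*} [NormedAddCommGroup E] [NormedSpace ℝ E]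
    [Fintype ι] [DecidableEq ι]
    {G : E → E →L[ℝ] E →L[ℝ] ℝ} {A : E → E →L[ℝ] E} {ξ : ι → E → E} {η : ι → E → E →L[ℝ] ℝ} {y₀ : E}
    (hG : DifferentiableAt ℝ G y₀) (hA : DifferentiableAt ℝ A y₀)
    (hξ : ∀ i, DifferentiableAt ℝ (ξ i) y₀) (hη : ∀ i, DifferentiableAt ℝ (η i) y₀)
    (G_symm : ∀ᶠ y in 𝓝 y₀, ∀ u v, G y u v = G y v u)
    (A_A : ∀ᶠ y in 𝓝 y₀, ∀ u, A y (A y u) = -u + ∑ i, η i y u • ξ i y)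
    (η_ξ : ∀ᶠ y in 𝓝 y₀, ∀ i j, η i y (ξ j y) = if i = j then 1 else 0)
    (A_ξ : ∀ᶠ y in 𝓝 y₀, ∀ i, A y (ξ i y) = 0)
    (η_A : ∀ᶠ y in 𝓝 y₀, ∀ i u, η i y (A y u) = 0)
    (η_eq : ∀ᶠ y in 𝓝 y₀, ∀ i u, η i y u = G y u (ξ i y))
    (G_A_A : ∀ᶠ y in 𝓝 y₀, ∀ u v, G y (A y u) (A y v) = G y u v - ∑ i, η i y u * η i y v)
    (nij : ∀ u v, fderiv ℝ A y₀ (A y₀ u) v - fderiv ℝ A y₀ (A y₀ v) u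
      + A y₀ (fderiv ℝ A y₀ v u) - A y₀ (fderiv ℝ A y₀ u v) = 0)
    (dΩ : ∀ u v w, fderiv ℝ (fun y => G y v (A y w)) y₀ u + fderiv ℝ (fun y => G y w (A y u)) y₀ v
      + fderiv ℝ (fun y => G y u (A y v)) y₀ w = 0)
    (dη : ∀ i u v, fderiv ℝ (η i) y₀ u v = fderiv ℝ (η i) y₀ v u) (i : ι) (u v : E) :
    2 * fderiv ℝ (η i) y₀ u v = fderiv ℝ G y₀ u v (ξ i y₀) + fderiv ℝ G y₀ v u (ξ i y₀)
      - fderiv ℝ G y₀ (ξ i y₀) u v := by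
  have hG' := hG.hasFDerivAt
  have hA' := hA.hasFDerivAt
  have hξ' := fun i => (hξ i).hasFDerivAt
  have hη' := fun i => (hη i).hasFDerivAt
  set G' := fderiv ℝ G y₀
  set A' := fderiv ℝ A y₀
  set ξ' := fun i => fderiv ℝ (ξ i) y₀ with hξ'def
  set η' := fun i => fderiv ℝ (η i) y₀ with hη'def
  change ∀ i, HasFDerivAt (ξ i) (ξ' i) y₀ at hξ'
  change ∀ i, HasFDerivAt (η i) (η' i) y₀ at hη'
  change ∀ i u v, η' i u v = η' i v u at dη
  change 2 * η' i u v = _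
  have hc : ∀ u : E, HasFDerivAt (fun _ : E => u) (0 : E →L[ℝ] E) y₀ :=
    fun u => hasFDerivAt_const u y₀
  have hΩ : ∀ a v w, fderiv ℝ (fun y => G y v (A y w)) y₀ a
      = G' a v (A y₀ w) + G y₀ v (A' a w) := by
    intro a v w
    rw [((hG'.clm_apply (hc v)).clm_apply (hA'.clm_apply (hc w))).fderiv]
    simp [add_comm]
  simp only [hΩ] at dΩ
  -- the algebraic identities at the base point
  have G_symm₀ := G_symm.self_of_nhds
  have A_A₀ := A_A.self_of_nhds
  have η_ξ₀ := η_ξ.self_of_nhds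
  have A_ξ₀ := A_ξ.self_of_nhds
  have η_A₀ := η_A.self_of_nhds
  have η_eq₀ := η_eq.self_of_nhds
  have G_A_A₀ := G_A_A.self_of_nhds
  -- their derivatives
  have G'_symm : ∀ a u v, G' a u v = G' a v u := by
    intro a u v
    have h1 := (hG'.clm_apply (hc u)).clm_apply (hc v)
    have h2 := (hG'.clm_apply (hc v)).clm_apply (hc u)
    have := h1.unique (h2.congr_of_eventuallyEq (G_symm.mono fun y hy => hy u v))
    simpa using congr($this a)
  have η'_ξ : ∀ i j a, η' i a (ξ j y₀) + η i y₀ (ξ' j a) = 0 := by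
    intro i j a
    have h1 := (hη' i).clm_apply (hξ' j)
    have := h1.unique ((hasFDerivAt_const _ y₀).congr_of_eventuallyEq
      (η_ξ.mono fun y hy => hy i j))
    simpa [add_comm] using congr($this a)
  have A'_ξ : ∀ i a, A' a (ξ i y₀) = - A y₀ (ξ' i a) := by
    intro i a
    have h1 := hA'.clm_apply (hξ' i)
    have := h1.unique ((hasFDerivAt_const (0 : E) y₀).congr_of_eventuallyEq
      (A_ξ.mono fun y hy => hy i))
    rw [eq_neg_iff_add_eq_zero]
    simpa [add_comm] using congr($this a)
  have η'_A : ∀ i a u, η' i a (A y₀ u) + η i y₀ (A' a u) = 0 := by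
    intro i a u
    have h1 := (hη' i).clm_apply (hA'.clm_apply (hc u))
    have := h1.unique ((hasFDerivAt_const (0 : ℝ) y₀).congr_of_eventuallyEq
      (η_A.mono fun y hy => hy i u))
    simpa [add_comm] using congr($this a)
  have η'_eq : ∀ i a u, η' i a u = G' a u (ξ i y₀) + G y₀ u (ξ' i a) := by
    intro i a u
    have h1 := (hη' i).clm_apply (hc u)
    have h2 := (hG'.clm_apply (hc u)).clm_apply (hξ' i)
    have := h1.unique (h2.congr_of_eventuallyEq (η_eq.mono fun y hy => hy i u))
    simpa [add_comm] using congr($this a)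
  have G'_A_A : ∀ a u v, G' a (A y₀ u) (A y₀ v) + G y₀ (A' a u) (A y₀ v) + G y₀ (A y₀ u) (A' a v)
      = G' a u v - ∑ i, (η' i a u * η i y₀ v + η i y₀ u * η' i a v) := by
    intro a u v
    have h1 := (hG'.clm_apply (hA'.clm_apply (hc u))).clm_apply (hA'.clm_apply (hc v))
    have h2 := ((hG'.clm_apply (hc u)).clm_apply (hc v)).sub
      (HasFDerivAt.fun_sum (u := Finset.univ)
        fun i _ => ((hη' i).clm_apply (hc u)).mul ((hη' i).clm_apply (hc v)))
    have := h1.unique (h2.congr_of_eventuallyEq (G_A_A.mono fun y hy => hy u v))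
    have := congr($this a)
    simp at this
    rw [Finset.sum_congr rfl fun i _ =>
      (by ring : η' i a u * η i y₀ v + η i y₀ u * η' i a v
        = η i y₀ u * η' i a v + η i y₀ v * η' i a u)]
    linarith
  -- `Ω` is skew-symmetric and `ξ` is in its kernel
  have Ω_skew : ∀ u v, G y₀ (A y₀ u) v = - G y₀ u (A y₀ v) := by
    intro u v
    have h := G_A_A₀ u (A y₀ v)
    simp only [A_A₀, η_A₀, map_add, map_neg, map_sum, map_smul, smul_eq_mul, mul_zero,
      Finset.sum_const_zero, sub_zero] at h
    rw [← h, Finset.sum_eq_zero fun i _ => ?_]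
    · ring
    · rw [← η_eq₀, η_A₀, mul_zero]
  -- `L_ξ A = 0`: with `z = (L_ξ A) u`, `nij` gives `A z = 0`, and `dη = 0` gives `η z = 0`
  have LA : ∀ i u, A' (ξ i y₀) u = ξ' i (A y₀ u) - A y₀ (ξ' i u) := by
    intro i u
    rw [← sub_eq_zero]
    set z := A' (ξ i y₀) u - (ξ' i (A y₀ u) - A y₀ (ξ' i u)) with hz
    have h1 : A y₀ z = 0 := by
      have h := nij u (ξ i y₀)
      rw [A_ξ₀, A'_ξ, A'_ξ] at h
      rw [hz]
      simp only [map_zero, map_neg, zero_apply, map_sub] at h ⊢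
      rw [← h]
      abel
    have h2 : ∀ j, η j y₀ z = 0 := by
      intro j
      have e1 := η'_A j (ξ i y₀) u
      have e2 := η'_ξ j i (A y₀ u)
      have e3 := dη j (ξ i y₀) (A y₀ u)
      rw [hz, map_sub, map_sub, η_A₀]
      linarith
    have h := A_A₀ z
    simp only [h1, h2, map_zero, zero_smul, Finset.sum_const_zero, add_zero] at h
    exact (neg_eq_zero.1 h.symm)
  -- `L_ξ Ω = 0`, from `dΩ(ξ, ·, ·) = 0` and the derivative of `Ω(·, ξ) = 0`
  have LΩ : ∀ i u v, G' (ξ i y₀) u (A y₀ v) + G y₀ u (A' (ξ i y₀) v)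
      = - G y₀ (ξ' i u) (A y₀ v) - G y₀ u (A y₀ (ξ' i v)) := by
    intro i u v
    have h := dΩ (ξ i y₀) u v
    rw [A_ξ₀, A'_ξ] at h
    have e1 : G' v (ξ i y₀) (A y₀ u) + G y₀ (ξ i y₀) (A' v u) + G y₀ (ξ' i v) (A y₀ u) = 0 := by
      have e := η'_eq i v (A y₀ u)
      have e' := η'_A i v u
      rw [G'_symm, G_symm₀ (ξ i y₀), G_symm₀ (ξ' i v), ← η_eq₀]
      linarith
    have e2 := Ω_skew v (ξ' i u)
    have e3 := Ω_skew u (ξ' i v)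
    have e4 := G_symm₀ (ξ' i v) (A y₀ u)
    have e5 := Ω_skew (ξ' i u) v
    have e6 := G_symm₀ (A y₀ v) (ξ' i u)
    simp only [map_zero, map_neg] at h
    linarith
  -- `L_ξ G = 0`, from `G = Ω(A ·, ·) + ∑ η ⊗ η`
  have killing : G' (ξ i y₀) u v + G y₀ (ξ' i u) v + G y₀ u (ξ' i v) = 0 := by
    have h := G'_A_A (ξ i y₀) u v
    have h1 := LΩ i (A y₀ u) v
    have h2 := G_A_A₀ u (ξ' i v)
    have h3 := G_A_A₀ (ξ' i u) v
    have h4 : ∑ j, (η' j (ξ i y₀) u * η j y₀ v + η j y₀ u * η' j (ξ i y₀) v)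
        = - ∑ j, η j y₀ (ξ' i u) * η j y₀ v - ∑ j, η j y₀ u * η j y₀ (ξ' i v) := by
      rw [← Finset.sum_neg_distrib, ← Finset.sum_sub_distrib]
      refine Finset.sum_congr rfl fun j _ => ?_
      rw [dη j _ u, dη j _ v, eq_neg_of_add_eq_zero_left (η'_ξ j i u),
        eq_neg_of_add_eq_zero_left (η'_ξ j i v)]
      ring
    have h5 : G y₀ (A' (ξ i y₀) u) (A y₀ v)
        = G y₀ (ξ' i (A y₀ u)) (A y₀ v) - G y₀ (A y₀ (ξ' i u)) (A y₀ v) := by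
      rw [LA, map_sub, sub_apply]
    linarith
  have e1 := η'_eq i u v
  have e2 := η'_eq i v u
  have e3 := dη i u v
  have e4 := G_symm₀ (ξ' i u) v
  linarith

section

variable {E : Type*} [NormedAddCommGroup E] [NormedSpace ℝ E]
variable {M : Type*} [TopologicalSpace M] [ChartedSpace E M] [IsManifold 𝓘(ℝ, E) ∞ M] {s : ℕ}

/-! ### Coordinate expressions of smooth tensor fields -/

omit [IsManifold 𝓘(ℝ, E) ∞ M] in
theorem differentiableAt_comp_extChartAt_symm {F : Type*} [NormedAddCommGroup F] [NormedSpace ℝ F]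
    {p : M} {f : M → F} (hf : ContMDiffAt 𝓘(ℝ, E) 𝓘(ℝ, F) ∞ f p) :
    DifferentiableAt ℝ (fun y => f ((extChartAt 𝓘(ℝ, E) p).symm y)) (extChartAt 𝓘(ℝ, E) p p) := by
  have h := (contMDiffAt_iff.1 hf).2
  simp only [ModelWithCorners.range_eq_univ, contDiffWithinAt_univ] at h
  exact h.differentiableAt (by simp)

theorem endInChart_differentiableAt
    {f : ∀ x : M, TangentSpace 𝓘(ℝ, E) x →L[ℝ] TangentSpace 𝓘(ℝ, E) x}
    (hf : ContMDiff 𝓘(ℝ, E) (𝓘(ℝ, E).prod 𝓘(ℝ, E →L[ℝ] E)) ∞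
      (fun x => TotalSpace.mk' (E →L[ℝ] E)
      (E := fun x : M => TangentSpace 𝓘(ℝ, E) x →L[ℝ] TangentSpace 𝓘(ℝ, E) x) x (f x))) (p : M) :
    DifferentiableAt ℝ (endInChart f p) (extChartAt 𝓘(ℝ, E) p p) := by
  have h := ((contMDiffAt_totalSpace).1 (hf p)).2
  exact differentiableAt_comp_extChartAt_symm h

theorem oneFormInChart_differentiableAt {a : ∀ x : M, TangentSpace 𝓘(ℝ, E) x →L[ℝ] ℝ}
    (ha : ContMDiff 𝓘(ℝ, E) (𝓘(ℝ, E).prod 𝓘(ℝ, E →L[ℝ] ℝ)) ∞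
    (fun x => TotalSpace.mk' (E →L[ℝ] ℝ)
      (E := fun x : M => TangentSpace 𝓘(ℝ, E) x →L[ℝ] ℝ) x (a x))) (p : M) :
    DifferentiableAt ℝ (oneFormInChart a p) (extChartAt 𝓘(ℝ, E) p p) := by
  have h := differentiableAt_comp_extChartAt_symm ((contMDiffAt_totalSpace).1 (ha p)).2
  refine h.congr_of_eventuallyEq (Eventually.of_forall fun y => ?_)
  refine ContinuousLinearMap.ext fun v => ?_
  change _ = ContinuousLinearMap.inCoordinates E (fun x : M => TangentSpace 𝓘(ℝ, E) x) ℝ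
    (Bundle.Trivial M ℝ) _ _ _ _ _ v
  simp [ContinuousLinearMap.inCoordinates]
  rfl

theorem eventually_mem_baseSet (p : M) :
    ∀ᶠ y in 𝓝 (extChartAt 𝓘(ℝ, E) p p), (extChartAt 𝓘(ℝ, E) p).symm y ∈
      (trivializationAt E (TangentSpace 𝓘(ℝ, E) (M := M)) p).baseSet := by
  have h := (continuousAt_extChartAt_symm (I := 𝓘(ℝ, E)) p).preimage_mem_nhds
    (t := (trivializationAt E (TangentSpace 𝓘(ℝ, E) (M := M)) p).baseSet) ?_
  · exact h
  · rw [extChartAt_to_inv]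
    exact (trivializationAt E (TangentSpace 𝓘(ℝ, E) (M := M)) p).open_baseSet.mem_nhds
      (FiberBundle.mem_baseSet_trivializationAt' p)

theorem bilinInChart_differentiableAt (g : Metric E M) (p : M) :
    DifferentiableAt ℝ (bilinInChart g.inner p) (extChartAt 𝓘(ℝ, E) p p) := by
  have h := differentiableAt_comp_extChartAt_symm ((contMDiffAt_totalSpace).1 (g.contMDiff p)).2
  refine h.congr_of_eventuallyEq ?_
  filter_upwards [eventually_mem_baseSet p] with y hy
  set x := (extChartAt 𝓘(ℝ, E) p).symm y with hx
  refine ContinuousLinearMap.ext fun u => ContinuousLinearMap.ext fun v => ?_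
  change _ = ContinuousLinearMap.inCoordinates E (fun x : M => TangentSpace 𝓘(ℝ, E) x) (E →L[ℝ] ℝ)
    (fun x : M => TangentSpace 𝓘(ℝ, E) x →L[ℝ] Bundle.Trivial M ℝ x) _ _ _ _ _ u v
  have hy' : x ∈ (trivializationAt (E →L[ℝ] ℝ)
      (fun x : M => TangentSpace 𝓘(ℝ, E) x →L[ℝ] Bundle.Trivial M ℝ x) p).baseSet := by
    rw [hom_trivializationAt_baseSet]
    exact ⟨hy, by simp⟩
  rw [ContinuousLinearMap.inCoordinates, ContinuousLinearMap.comp_apply,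
    Trivialization.continuousLinearMapAt_apply, Trivialization.coe_linearMapAt_of_mem _ hy']
  change _ = ContinuousLinearMap.inCoordinates E (fun x : M => TangentSpace 𝓘(ℝ, E) x) ℝ
    (Bundle.Trivial M ℝ) _ _ _ _ _ v
  simp [ContinuousLinearMap.inCoordinates]
  rfl

theorem vectorInChart_differentiableAt {X : ∀ x : M, TangentSpace 𝓘(ℝ, E) x}
    (hX : ContMDiff 𝓘(ℝ, E) 𝓘(ℝ, E).tangent ∞
      (fun x => (⟨x, X x⟩ : TangentBundle 𝓘(ℝ, E) M))) (p : M) :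
    DifferentiableAt ℝ (fun y => chartDiff p ((extChartAt 𝓘(ℝ, E) p).symm y)
      (X ((extChartAt 𝓘(ℝ, E) p).symm y))) (extChartAt 𝓘(ℝ, E) p p) := by
  have h := differentiableAt_comp_extChartAt_symm ((contMDiffAt_totalSpace).1 (hX p)).2
  refine h.congr_of_eventuallyEq ?_
  filter_upwards [eventually_mem_baseSet p] with y hy
  rw [chartDiff, Trivialization.continuousLinearMapAt_apply,
    Trivialization.coe_linearMapAt_of_mem _ hy]

theorem chartDiffSymm_chartDiff {p x : M}
    (hx : x ∈ (trivializationAt E (TangentSpace 𝓘(ℝ, E) (M := M)) p).baseSet)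
    (u : TangentSpace 𝓘(ℝ, E) x) : chartDiffSymm p x (chartDiff p x u) = u :=
  Trivialization.symmL_continuousLinearMapAt _ hx u

theorem chartDiff_chartDiffSymm {p x : M}
    (hx : x ∈ (trivializationAt E (TangentSpace 𝓘(ℝ, E) (M := M)) p).baseSet)
    (u : E) : chartDiff p x (chartDiffSymm p x u) = u :=
  Trivialization.continuousLinearMapAt_symmL _ hx u

theorem oneFormInChart_apply (a : ∀ x : M, TangentSpace 𝓘(ℝ, E) x →L[ℝ] ℝ) (p : M) (y u : E) :
    oneFormInChart a p y u = a ((extChartAt 𝓘(ℝ, E) p).symm y) (chartDiffSymm p _ u) := rfl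

theorem bilinInChart_apply
    (b : ∀ x : M, TangentSpace 𝓘(ℝ, E) x →L[ℝ] TangentSpace 𝓘(ℝ, E) x →L[ℝ] ℝ) (p : M)
    (y u v : E) :
    bilinInChart b p y u v
      = b ((extChartAt 𝓘(ℝ, E) p).symm y) (chartDiffSymm p _ u) (chartDiffSymm p _ v) := rfl

theorem endInChart_apply (f : ∀ x : M, TangentSpace 𝓘(ℝ, E) x →L[ℝ] TangentSpace 𝓘(ℝ, E) x) (p : M)
    (y u : E) : endInChart f p y u
      = chartDiff p _ (f ((extChartAt 𝓘(ℝ, E) p).symm y) (chartDiffSymm p _ u)) := rfl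

theorem Metric.inner_sharp [FiniteDimensional ℝ E] (g : Metric E M) (p : M)
    (a : Module.Dual ℝ (TangentSpace 𝓘(ℝ, E) p)) (w : TangentSpace 𝓘(ℝ, E) p) :
    g.inner p (g.sharp p a) w = a w := by
  have : FiniteDimensional ℝ (TangentSpace 𝓘(ℝ, E) p) := inferInstanceAs (FiniteDimensional ℝ E)
  exact LinearMap.BilinForm.apply_toDual_symm_apply (hB := g.bilin_nondegenerate p) a w

/-! ### The structure forms are parallel -/

/-- The Nijenhuis tensor through the partial derivatives of the coordinate expression of `f`. -/
theorem nijenhuis_eq {f : ∀ x : M, TangentSpace 𝓘(ℝ, E) x →L[ℝ] TangentSpace 𝓘(ℝ, E) x} {p : M}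
    (hf : DifferentiableAt ℝ (endInChart f p) (extChartAt 𝓘(ℝ, E) p p))
    (u v : TangentSpace 𝓘(ℝ, E) p) :
    nijenhuis f p u v = chartDiffSymm p p
      (fderiv ℝ (endInChart f p) (extChartAt 𝓘(ℝ, E) p p)
          (endInChart f p (extChartAt 𝓘(ℝ, E) p p) (chartDiff p p u)) (chartDiff p p v)
        - fderiv ℝ (endInChart f p) (extChartAt 𝓘(ℝ, E) p p)
          (endInChart f p (extChartAt 𝓘(ℝ, E) p p) (chartDiff p p v)) (chartDiff p p u)
        + endInChart f p (extChartAt 𝓘(ℝ, E) p p)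
          (fderiv ℝ (endInChart f p) (extChartAt 𝓘(ℝ, E) p p) (chartDiff p p v) (chartDiff p p u))
        - endInChart f p (extChartAt 𝓘(ℝ, E) p p)
          (fderiv ℝ (endInChart f p) (extChartAt 𝓘(ℝ, E) p p)
            (chartDiff p p u) (chartDiff p p v))) := by
  have h : ∀ w a : E, fderiv ℝ (fun y => endInChart f p y w) (extChartAt 𝓘(ℝ, E) p p) a
      = fderiv ℝ (endInChart f p) (extChartAt 𝓘(ℝ, E) p p) a w := by
    intro w a
    rw [(hf.hasFDerivAt.clm_apply (hasFDerivAt_const w _)).fderiv]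
    simp
  unfold nijenhuis
  simp only [VectorField.lieBracket, h]
  simp [map_add, map_sub]

namespace FramedStructure

/-- The identity `∂_u η^α(v) = Γ(u, v; ξ_α)` in the chart at `p`, that is `∇ η^α = 0` at `p`. -/
theorem fderiv_oneFormInChart_eta {S : FramedStructure E M s} (hS : S.IsCManifold) (p : M)
    (α : Fin s) (u v : E) :
    fderiv ℝ (oneFormInChart (S.η α) p) (extChartAt 𝓘(ℝ, E) p p) u v
      = S.g.christoffelFirst p u v (chartDiff p p (S.ξ α p)) := by
  have hp := FiberBundle.mem_baseSet_trivializationAt' (F := E)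
    (E := (TangentSpace 𝓘(ℝ, E) : M → Type _)) p
  have hev := eventually_mem_baseSet (E := E) p
  have hG := bilinInChart_differentiableAt S.g p
  have hA := endInChart_differentiableAt S.φ_smooth p
  have hsymm : ∀ a : E, chartDiff p p (chartDiffSymm p p a) = a := fun a =>
    chartDiff_chartDiffSymm hp a
  -- in the chart at `p`, every pointwise identity of `S` holds for the coordinate expressions as long
  -- as the differential of the chart is invertible, hence near the base point
  have key := two_mul_fderiv_oneForm_eq_christoffel
    (G := bilinInChart S.g.inner p) (A := endInChart S.φ p)
    (ξ := fun α y => chartDiff p ((extChartAt 𝓘(ℝ, E) p).symm y)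
      (S.ξ α ((extChartAt 𝓘(ℝ, E) p).symm y)))
    (η := fun α => oneFormInChart (S.η α) p) (y₀ := extChartAt 𝓘(ℝ, E) p p)
    hG hA
    (fun α => vectorInChart_differentiableAt (S.ξ_smooth α) p)
    (fun α => oneFormInChart_differentiableAt (S.η_smooth α) p)
    (Eventually.of_forall fun y u v => S.g.symm _ _ _)
    (hev.mono fun y hy u => by
      simp only [endInChart_apply, oneFormInChart_apply, chartDiffSymm_chartDiff hy, S.φ_φ,
        map_add, map_neg, map_sum, map_smul, chartDiff_chartDiffSymm hy])
    (hev.mono fun y hy α β => by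
      simp only [oneFormInChart_apply, chartDiffSymm_chartDiff hy, S.η_ξ])
    (hev.mono fun y hy α => by
      simp only [endInChart_apply, chartDiffSymm_chartDiff hy, S.φ_ξ, map_zero])
    (hev.mono fun y hy α u => by
      simp only [endInChart_apply, oneFormInChart_apply, chartDiffSymm_chartDiff hy, S.η_φ])
    (hev.mono fun y hy α u => by
      simp only [bilinInChart_apply, oneFormInChart_apply, chartDiffSymm_chartDiff hy, S.η_eq])
    (hev.mono fun y hy u v => by
      simp only [endInChart_apply, bilinInChart_apply, oneFormInChart_apply,
        chartDiffSymm_chartDiff hy, S.g_φ_φ])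
    (fun u v => by
      have h := hS.normal p (chartDiffSymm p p u) (chartDiffSymm p p v)
      simp only [hS.dη_eq_zero, zero_smul, Finset.sum_const_zero, smul_zero, nijenhuis_eq hA,
        hsymm] at h
      rw [← hsymm (_ - _), h, map_zero])
    (fun u v w => by
      have h := hS.dΩ_eq_zero p (chartDiffSymm p p u) (chartDiffSymm p p v) (chartDiffSymm p p w)
      simp only [extDerivTwoForm, hsymm] at h
      have hΩ : ∀ a b : E, (fun y => bilinInChart S.Ω p y a b) =ᶠ[𝓝 (extChartAt 𝓘(ℝ, E) p p)]
          fun y => bilinInChart S.g.inner p y a (endInChart S.φ p y b) := by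
        intro a b
        filter_upwards [hev] with y hy
        rw [bilinInChart_apply, bilinInChart_apply, endInChart_apply, chartDiffSymm_chartDiff hy]
        rfl
      simp only [(hΩ _ _).fderiv_eq] at h
      linarith)
    (fun α u v => by
      have h := hS.dη_eq_zero α p (chartDiffSymm p p u) (chartDiffSymm p p v)
      simp only [extDerivOneForm, hsymm] at h
      linarith)
    α u v
  have h : ∀ w a : E, fderiv ℝ (fun y => bilinInChart S.g.inner p y w) (extChartAt 𝓘(ℝ, E) p p) a
      = fderiv ℝ (bilinInChart S.g.inner p) (extChartAt 𝓘(ℝ, E) p p) a w := by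
    intro w a
    rw [(hG.hasFDerivAt.clm_apply (hasFDerivAt_const w _)).fderiv]
    simp
  have h2 : ∀ w w' a : E, fderiv ℝ (fun y => bilinInChart S.g.inner p y w w')
      (extChartAt 𝓘(ℝ, E) p p) a
      = fderiv ℝ (bilinInChart S.g.inner p) (extChartAt 𝓘(ℝ, E) p p) a w w' := by
    intro w w' a
    rw [((hG.hasFDerivAt.clm_apply (hasFDerivAt_const w _)).clm_apply
      (hasFDerivAt_const w' _)).fderiv]
    simp
  simp only [Metric.christoffelFirst, smul_apply, sub_apply, add_apply, h, h2, smul_eq_mul]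
  have hξ : chartDiff p ((extChartAt 𝓘(ℝ, E) p).symm (extChartAt 𝓘(ℝ, E) p p))
      (S.ξ α ((extChartAt 𝓘(ℝ, E) p).symm (extChartAt 𝓘(ℝ, E) p p))) = chartDiff p p (S.ξ α p) := by
    rw [extChartAt_to_inv]
  rw [hξ] at key
  linarith

end FramedStructure

theorem hasDerivAt_extChartAt_comp {γ : ℝ → M} {t : ℝ}
    (hγ : MDifferentiableAt 𝓘(ℝ, ℝ) 𝓘(ℝ, E) γ t) :
    HasDerivAt (fun τ => extChartAt 𝓘(ℝ, E) (γ t) (γ τ))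
      (chartDiff (γ t) (γ t) (velocity γ t)) t := by
  have h1 : MDifferentiableAt 𝓘(ℝ, E) 𝓘(ℝ, E) (extChartAt 𝓘(ℝ, E) (γ t)) (γ t) :=
    mdifferentiableAt_extChartAt (mem_chart_source E (γ t))
  have h2 := (h1.hasMFDerivAt.comp t hγ.hasMFDerivAt).hasFDerivAt
  rw [← TangentBundle.continuousLinearMapAt_trivializationAt (mem_chart_source E (γ t))] at h2
  have h3 : HasFDerivAt (fun τ => extChartAt 𝓘(ℝ, E) (γ t) (γ τ))
      ((chartDiff (γ t) (γ t)).comp (mfderiv 𝓘(ℝ, ℝ) 𝓘(ℝ, E) γ t) : ℝ →L[ℝ] E) t := h2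
  exact h3.hasDerivAt

theorem SmoothAlong.differentiableAt_chartDiff {γ : ℝ → M} {J : Set ℝ}
    {V : ∀ t : ℝ, TangentSpace 𝓘(ℝ, E) (γ t)} (hV : SmoothAlong γ J V) {t : ℝ} (hJt : J ∈ 𝓝 t)
    (hb : ∀ᶠ τ in 𝓝 t, γ τ ∈
      (trivializationAt E (TangentSpace 𝓘(ℝ, E) (M := M)) (γ t)).baseSet) :
    DifferentiableAt ℝ (fun τ => chartDiff (γ t) (γ τ) (V τ)) t := by
  have h := ((contMDiffAt_totalSpace).1 (hV.contMDiffAt hJt)).2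
  refine (h.contDiffAt.differentiableAt (by simp)).congr_of_eventuallyEq ?_
  filter_upwards [hb] with τ hτ
  rw [chartDiff, Trivialization.continuousLinearMapAt_apply,
    Trivialization.coe_linearMapAt_of_mem _ hτ]

theorem FramedStructure.eta_covDeriv [FiniteDimensional ℝ E] {S : FramedStructure E M s}
    (hS : S.IsCManifold) (γ : ℝ → M) (V : ∀ t : ℝ, TangentSpace 𝓘(ℝ, E) (γ t)) (t : ℝ) (α : Fin s) :
    S.η α (γ t) (S.g.covDeriv γ V t)
      = fderiv ℝ (oneFormInChart (S.η α) (γ t)) (extChartAt 𝓘(ℝ, E) (γ t) (γ t))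
          (chartDiff (γ t) (γ t) (velocity γ t)) (chartDiff (γ t) (γ t) (V t))
        + oneFormInChart (S.η α) (γ t) (extChartAt 𝓘(ℝ, E) (γ t) (γ t))
          (deriv (fun τ : ℝ => chartDiff (γ t) (γ τ) (V τ)) t) := by
  have h1 : S.η α (γ t) (S.g.christoffel (γ t) (velocity γ t) (V t)) =
      S.g.christoffelFirst (γ t) (chartDiff (γ t) (γ t) (velocity γ t))
        (chartDiff (γ t) (γ t) (V t)) (chartDiff (γ t) (γ t) (S.ξ α (γ t))) := by
    rw [S.η_eq, Metric.christoffel, S.g.inner_sharp]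
    rfl
  rw [Metric.covDeriv, map_add, fderiv_oneFormInChart_eta hS, h1, add_comm,
    oneFormInChart_apply, extChartAt_to_inv]

/-- The structure forms of a `C`-manifold are parallel, as seen along a curve. -/
theorem FramedStructure.hasDerivAt_eta [FiniteDimensional ℝ E] {S : FramedStructure E M s}
    (hS : S.IsCManifold) {γ : ℝ → M} {J : Set ℝ} (hJ : IsOpen J)
    (hγ : ContMDiffOn 𝓘(ℝ, ℝ) 𝓘(ℝ, E) ∞ γ J) {V : ∀ t : ℝ, TangentSpace 𝓘(ℝ, E) (γ t)}
    (hV : SmoothAlong γ J V) {t : ℝ} (ht : t ∈ J) (α : Fin s) :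
    HasDerivAt (fun τ => S.η α (γ τ) (V τ)) (S.η α (γ t) (S.g.covDeriv γ V t)) t := by
  have hJt := hJ.mem_nhds ht
  have hγt : MDifferentiableAt 𝓘(ℝ, ℝ) 𝓘(ℝ, E) γ t :=
    (hγ.contMDiffAt hJt).mdifferentiableAt (by simp)
  have hb : ∀ᶠ τ in 𝓝 t, γ τ ∈
      (trivializationAt E (TangentSpace 𝓘(ℝ, E) (M := M)) (γ t)).baseSet :=
    hγt.continuousAt.preimage_mem_nhds
      ((trivializationAt E (TangentSpace 𝓘(ℝ, E) (M := M)) (γ t)).open_baseSet.mem_nhds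
        (FiberBundle.mem_baseSet_trivializationAt' (γ t)))
  have hs : ∀ᶠ τ in 𝓝 t, γ τ ∈ (extChartAt 𝓘(ℝ, E) (γ t)).source :=
    hγt.continuousAt.preimage_mem_nhds (extChartAt_source_mem_nhds (γ t))
  have hy := hasDerivAt_extChartAt_comp hγt
  have hW := (hV.differentiableAt_chartDiff hJt hb).hasDerivAt
  have hη := (oneFormInChart_differentiableAt (S.η_smooth α) (γ t)).hasFDerivAt
  rw [eta_covDeriv hS]
  have hc := hη.comp_hasDerivAt t hy
  generalize deriv (fun τ : ℝ => chartDiff (γ t) (γ τ) (V τ)) t = W' at hW ⊢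
  have h1 := hc.clm_apply hW
  refine h1.congr_of_eventuallyEq ?_
  filter_upwards [hb, hs] with τ hτ hτ'
  rw [Function.comp_apply]
  rw [oneFormInChart_apply, (extChartAt 𝓘(ℝ, E) (γ t)).left_inv hτ', chartDiffSymm_chartDiff hτ]

/-! ### Covariant derivatives and the algebra of a framed structure -/

theorem Metric.eq_zero_of_inner_self (g : Metric E M) {p : M} {u : TangentSpace 𝓘(ℝ, E) p}
    (h : g.inner p u u = 0) : u = 0 := by
  by_contra hu
  exact (g.pos p u hu).ne' h

theorem Metric.ext_inner (g : Metric E M) {p : M} {u u' : TangentSpace 𝓘(ℝ, E) p}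
    (h : ∀ w, g.inner p u w = g.inner p u' w) : u = u' := by
  rw [← sub_eq_zero]
  apply g.eq_zero_of_inner_self
  rw [map_sub (g.inner p), sub_apply, h, sub_self]

theorem Metric.covDeriv_congr [FiniteDimensional ℝ E] (g : Metric E M) {γ : ℝ → M} {t : ℝ}
    {V W : ∀ t : ℝ, TangentSpace 𝓘(ℝ, E) (γ t)} (h : ∀ᶠ τ in 𝓝 t, V τ = W τ) :
    g.covDeriv γ V t = g.covDeriv γ W t := by
  have h1 : (fun τ : ℝ => chartDiff (γ t) (γ τ) (V τ)) =ᶠ[𝓝 t]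
      fun τ => chartDiff (γ t) (γ τ) (W τ) := h.mono fun τ hτ => by
    simp only [hτ]
  rw [Metric.covDeriv, Metric.covDeriv, h1.deriv_eq, h.self_of_nhds]

namespace FramedStructure
variable (S : FramedStructure E M s)

theorem inner_phi_left (p : M) (u w : TangentSpace 𝓘(ℝ, E) p) :
    S.g.inner p (S.φ p u) w = - S.g.inner p u (S.φ p w) := by
  have h := S.g_φ_φ p u (S.φ p w)
  simp only [S.φ_φ, S.η_φ, map_add, map_neg, map_sum, map_smul, smul_eq_mul, mul_zero,
    Finset.sum_const_zero, sub_zero, ← S.η_eq, add_zero] at h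
  linarith

theorem inner_phi_self (p : M) (u : TangentSpace 𝓘(ℝ, E) p) : S.g.inner p (S.φ p u) u = 0 := by
  have h := S.inner_phi_left p u u
  rw [S.g.symm p u] at h
  linarith

theorem inner_phi_comm (p : M) (u w : TangentSpace 𝓘(ℝ, E) p) :
    S.g.inner p (S.φ p u) w = - S.g.inner p (S.φ p w) u := by
  rw [S.inner_phi_left, S.g.symm]

theorem inner_phi_xi (p : M) (u : TangentSpace 𝓘(ℝ, E) p) (α : Fin s) :
    S.g.inner p (S.φ p u) (S.ξ α p) = 0 := by
  rw [← S.η_eq, S.η_φ]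

theorem sq_eta_le (p : M) (u : TangentSpace 𝓘(ℝ, E) p) (α : Fin s) :
    S.η α p u ^ 2 ≤ S.g.inner p u u := by
  have h := S.g_φ_φ p u u
  have h0 : 0 ≤ S.g.inner p (S.φ p u) (S.φ p u) := by
    by_cases hz : S.φ p u = 0
    · simp [hz]
    · exact (S.g.pos p _ hz).le
  have h1 : S.η α p u ^ 2 ≤ ∑ β, S.η β p u ^ 2 :=
    Finset.single_le_sum (f := fun β => S.η β p u ^ 2) (fun β _ => sq_nonneg _) (Finset.mem_univ α)
  simp only [sq] at h1 ⊢
  linarith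

theorem lorentzForce_magneticField [FiniteDimensional ℝ E] (q : ℝ) (p : M)
    (u : TangentSpace 𝓘(ℝ, E) p) :
    lorentzForce S.g (S.magneticField q) p u = -q • S.φ p u := by
  apply S.g.ext_inner
  intro w
  rw [lorentzForce, S.g.inner_sharp, map_smul, smul_apply, S.inner_phi_left]
  change q • S.g.inner p u (S.φ p w) = _
  simp

/-- The Lorentz equation in terms of the first Frenet field, which agrees with the velocity only on
`J`; the covariant derivative does not see the difference since `J` is open. -/
theorem isMagneticCurve_iff [FiniteDimensional ℝ E] {γ : ℝ → M}
    {J : Set ℝ} (hJ : IsOpen J) {r : ℕ}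
    {v : ℕ → ∀ t : ℝ, TangentSpace 𝓘(ℝ, E) (γ t)} {κ : ℕ → ℝ → ℝ}
    (h : IsFrenetCurve S.g γ J r v κ) (q : ℝ) :
    IsMagneticCurve S.g (S.magneticField q) γ J ↔
      ∀ t ∈ J, S.g.covDeriv γ (v 1) t = -q • S.φ (γ t) (v 1 t) := by
  have h1 : ∀ t ∈ J, S.g.covDeriv γ (velocity γ) t = S.g.covDeriv γ (v 1) t := fun t ht =>
    S.g.covDeriv_congr (by
      filter_upwards [hJ.mem_nhds ht] with τ hτ
      exact (h.frame_one τ hτ).symm)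
  simp only [IsMagneticCurve, h.smooth, true_and]
  refine forall₂_congr fun t ht => ?_
  rw [h1 t ht, ← h.frame_one t ht, S.lorentzForce_magneticField]

/-- A vector of the frame space which is orthogonal to its generators vanishes. -/
theorem eq_zero_of_mem_frameSpan {γ : ℝ → M} {r : ℕ}
    {v : ℕ → ∀ t : ℝ, TangentSpace 𝓘(ℝ, E) (γ t)} {t : ℝ} {z : TangentSpace 𝓘(ℝ, E) (γ t)}
    (hz : z ∈ S.frameSpan γ r v t) (hv : ∀ i, 1 ≤ i → i ≤ r → S.g.inner (γ t) z (v i t) = 0)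
    (hξ : r ≤ 2 → ∀ α, S.g.inner (γ t) z (S.ξ α (γ t)) = 0) : z = 0 := by
  have h : S.frameSpan γ r v t ≤ LinearMap.ker (S.g.inner (γ t) z : _ →ₗ[ℝ] ℝ) := by
    refine sup_le (Submodule.span_le.2 ?_) ?_
    · rintro _ ⟨i, hi, rfl⟩
      exact hv i hi.1 hi.2
    · split_ifs with hr
      · refine Submodule.span_le.2 ?_
        rintro _ ⟨α, rfl⟩
        exact hξ hr α
      · exact bot_le
  exact S.g.eq_zero_of_inner_self (h hz)

theorem mem_frameSpan {γ : ℝ → M} {r : ℕ} (v : ℕ → ∀ t : ℝ, TangentSpace 𝓘(ℝ, E) (γ t)) (t : ℝ)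
    {i : ℕ} (h1 : 1 ≤ i) (h2 : i ≤ r) : v i t ∈ S.frameSpan γ r v t :=
  Submodule.mem_sup_left (Submodule.subset_span ⟨i, ⟨h1, h2⟩, rfl⟩)

variable {S}

/-! ### The tensor `φ` on the Frenet frame of a `φ`-helix -/

section
variable [FiniteDimensional ℝ E] {γ : ℝ → M} {J : Set ℝ} {r : ℕ}
    {v : ℕ → ∀ t : ℝ, TangentSpace 𝓘(ℝ, E) (γ t)} {κ : ℕ → ℝ}

/-- For order `1`, the vector `φ T` lies in `sp{T, ξ_1, …, ξ_s}` and is orthogonal to it. -/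
theorem IsPhiHelix.phi_eq_zero (h : S.IsPhiHelix γ J 1 v κ) {t : ℝ} (ht : t ∈ J) :
    S.φ (γ t) (v 1 t) = 0 := by
  refine S.eq_zero_of_mem_frameSpan (h.2 t ht _ (S.mem_frameSpan v t le_rfl le_rfl)) ?_ ?_
  · intro i h1 h2
    obtain rfl : i = 1 := by omega
    exact S.inner_phi_self _ _
  · exact fun _ α => S.inner_phi_xi _ _ α

/-- The derivative of the constant `η(T)` along the curve is `κ₁ η(v₂)`. -/
theorem IsPhiHelix.eta_two_eq_zero (hS : S.IsCManifold) (hJ : IsOpen J)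
    (h : S.IsPhiHelix γ J r v κ) (hr : 2 ≤ r) {c : Fin s → ℝ}
    (hc : ∀ t ∈ J, ∀ α, S.η α (γ t) (v 1 t) = c α) {t : ℝ} (ht : t ∈ J) (α : Fin s) :
    S.η α (γ t) (v 2 t) = 0 := by
  have h1 := hasDerivAt_eta hS hJ h.1.smooth (h.1.frame_smooth 1 le_rfl h.1.one_le) ht α
  have h2 : HasDerivAt (fun τ => S.η α (γ τ) (v 1 τ)) 0 t :=
    (hasDerivAt_const t (c α)).congr_of_eventuallyEq (by
      filter_upwards [hJ.mem_nhds ht] with τ hτ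
      exact hc τ hτ α)
  have h3 := h1.unique h2
  rw [h.1.frenet t ht 1 le_rfl h.1.one_le, if_neg (by omega), if_pos (by omega), zero_add,
    map_smul, smul_eq_mul] at h3
  exact (mul_eq_zero.1 h3).resolve_left (h.1.curvature_pos t ht 1 le_rfl (by omega)).ne'

/-- The derivative of `η(v₂) = 0` along the curve, with the Frenet formula for `∇_T v₂`. -/
theorem IsPhiHelix.eta_covDeriv_two (hS : S.IsCManifold) (hJ : IsOpen J)
    (h : S.IsPhiHelix γ J r v κ) (hr : 2 ≤ r) {c : Fin s → ℝ}
    (hc : ∀ t ∈ J, ∀ α, S.η α (γ t) (v 1 t) = c α) {t : ℝ} (ht : t ∈ J) (α : Fin s) :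
    (if 2 < r then κ 2 * S.η α (γ t) (v 3 t) else 0) = κ 1 * S.η α (γ t) (v 1 t) := by
  have h1 := hasDerivAt_eta hS hJ h.1.smooth (h.1.frame_smooth 2 (by omega) hr) ht α
  have h2 : HasDerivAt (fun τ => S.η α (γ τ) (v 2 τ)) 0 t :=
    (hasDerivAt_const t 0).congr_of_eventuallyEq (by
      filter_upwards [hJ.mem_nhds ht] with τ hτ
      exact h.eta_two_eq_zero hS hJ hr hc hτ α)
  have h3 := h1.unique h2
  rw [h.1.frenet t ht 2 (by omega) hr, if_pos (by omega)] at h3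
  split_ifs at h3 ⊢ <;>
  simp only [map_add, map_smul, smul_eq_mul, map_zero] at h3 <;> linarith

/-- On the frame of a `φ`-helix of order `2` or `3` with constant `η(T)`, the vector `φ T` is a
multiple of `v₂`, determined up to its sign, and `∑ η^α(T)²` is determined by the curvatures. For order
`3`, the Gram matrix of `φ T`, `φ v₂`, `φ v₃` is computed both from `g_φ_φ` and from the
skew-symmetric matrix of `φ` in the frame. -/
theorem IsPhiHelix.phi_velocity (hS : S.IsCManifold) (hJ : IsOpen J)
    (h : S.IsPhiHelix γ J r v κ) (hr2 : 2 ≤ r) (hr3 : r ≤ 3) {c : Fin s → ℝ}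
    (hc : ∀ t ∈ J, ∀ α, S.η α (γ t) (v 1 t) = c α) {t : ℝ} (ht : t ∈ J) :
    S.φ (γ t) (v 1 t) = S.g.inner (γ t) (S.φ (γ t) (v 1 t)) (v 2 t) • v 2 t ∧
      S.g.inner (γ t) (S.φ (γ t) (v 1 t)) (v 2 t) ^ 2 * (κ 1 ^ 2 + κ 2 ^ 2) = κ 1 ^ 2 ∧
      (∑ α, c α ^ 2) * (κ 1 ^ 2 + κ 2 ^ 2) = κ 2 ^ 2 := by
  have hη2 : ∀ α, S.η α (γ t) (v 2 t) = 0 := h.eta_two_eq_zero hS hJ hr2 hc ht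
  have hη3 := h.eta_covDeriv_two hS hJ hr2 hc ht
  have hκ1 : 0 < κ 1 := h.1.curvature_pos t ht 1 le_rfl (by omega)
  have hφ1 := h.2 t ht _ (S.mem_frameSpan v t le_rfl h.1.one_le)
  have hφ2 := h.2 t ht _ (S.mem_frameSpan v t one_le_two hr2)
  have hv2 := S.mem_frameSpan v t one_le_two hr2
  have g11 := h.1.orthonormal t ht 1 1 le_rfl h.1.one_le le_rfl h.1.one_le
  have g21 := h.1.orthonormal t ht 2 1 one_le_two hr2 le_rfl h.1.one_le
  have g22 := h.1.orthonormal t ht 2 2 one_le_two hr2 one_le_two hr2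
  rw [if_pos rfl] at g11 g22
  rw [if_neg (by omega)] at g21
  have n1 := S.g_φ_φ (γ t) (v 1 t) (v 1 t)
  simp only [hc t ht, g11] at n1
  obtain rfl | rfl : r = 2 ∨ r = 3 := by omega
  · have hκ2 : κ 2 = 0 := h.1.curvature_zero t ht 2 le_rfl
    have hc0 : ∀ α, c α = 0 := fun α => by
      have := hη3 α
      rw [if_neg (by omega), hc t ht, zero_eq_mul] at this
      exact this.resolve_left hκ1.ne'
    have key : S.φ (γ t) (v 1 t)
        - S.g.inner (γ t) (S.φ (γ t) (v 1 t)) (v 2 t) • v 2 t = 0 := by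
      refine S.eq_zero_of_mem_frameSpan (sub_mem hφ1 (Submodule.smul_mem _ _ hv2)) ?_ ?_
      · intro i h1 h2
        obtain rfl | rfl : i = 1 ∨ i = 2 := by omega
        · simp [S.inner_phi_self, g21]
        · simp [g22]
      · intro _ α
        simp [S.inner_phi_xi, ← S.η_eq, hη2]
    rw [sub_eq_zero] at key
    have e : ∀ w, S.g.inner (γ t) w (S.φ (γ t) (v 1 t))
        = S.g.inner (γ t) (S.φ (γ t) (v 1 t)) (v 2 t) * S.g.inner (γ t) w (v 2 t) := by
      intro w
      conv_lhs => rw [key]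
      simp
    rw [e] at n1
    refine ⟨key, ?_, ?_⟩
    · simp only [hc0, hκ2] at n1 ⊢
      simp at n1
      rw [pow_two (S.g.inner _ _ _), n1]
      ring
    · simp [hc0, hκ2]
  · have hκ2 : 0 < κ 2 := h.1.curvature_pos t ht 2 one_le_two (by omega)
    simp only [if_pos (show 2 < 3 by omega), hc t ht] at hη3
    have hv1 := S.mem_frameSpan (r := 3) v t le_rfl (by omega)
    have hv3 := S.mem_frameSpan (r := 3) v t (i := 3) (by omega) le_rfl
    have g31 := h.1.orthonormal t ht 3 1 (by omega) (by omega) (by omega) (by omega)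
    have g32 := h.1.orthonormal t ht 3 2 (by omega) (by omega) (by omega) (by omega)
    have g33 := h.1.orthonormal t ht 3 3 (by omega) (by omega) (by omega) (by omega)
    rw [if_neg (by omega)] at g31 g32
    rw [if_pos rfl] at g33
    have g12 := (S.g.symm (γ t) (v 1 t) (v 2 t)).trans g21
    have g13 := (S.g.symm (γ t) (v 1 t) (v 3 t)).trans g31
    have g23 := (S.g.symm (γ t) (v 2 t) (v 3 t)).trans g32
    have s21 := S.inner_phi_comm (γ t) (v 2 t) (v 1 t)
    have s31 := S.inner_phi_comm (γ t) (v 3 t) (v 1 t)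
    have s32 := S.inner_phi_comm (γ t) (v 3 t) (v 2 t)
    have s11 := S.inner_phi_self (γ t) (v 1 t)
    have s22 := S.inner_phi_self (γ t) (v 2 t)
    have s33 := S.inner_phi_self (γ t) (v 3 t)
    -- for order `3` the frame is an orthonormal basis of the frame space
    have expand : ∀ z ∈ S.frameSpan γ 3 v t, z = S.g.inner (γ t) z (v 1 t) • v 1 t
        + S.g.inner (γ t) z (v 2 t) • v 2 t + S.g.inner (γ t) z (v 3 t) • v 3 t := by
      intro z hz
      rw [← sub_eq_zero]
      refine S.eq_zero_of_mem_frameSpan (sub_mem hz (add_mem (add_mem (Submodule.smul_mem _ _ hv1)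
        (Submodule.smul_mem _ _ hv2)) (Submodule.smul_mem _ _ hv3))) ?_ (by omega)
      intro i h1 h2
      obtain rfl | rfl | rfl : i = 1 ∨ i = 2 ∨ i = 3 := by omega
      all_goals simp [g11, g21, g22, g31, g32, g33, g12, g13, g23]
    have n2 := S.g_φ_φ (γ t) (v 2 t) (v 2 t)
    have n3 := S.g_φ_φ (γ t) (v 3 t) (v 3 t)
    have n21 := S.g_φ_φ (γ t) (v 2 t) (v 1 t)
    have n32 := S.g_φ_φ (γ t) (v 3 t) (v 2 t)
    have x1 := expand _ hφ1
    have x2 := expand _ hφ2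
    have x3 := expand _ (h.2 t ht _ hv3)
    rw [s11, zero_smul, zero_add] at x1
    rw [s21, s22, zero_smul, add_zero] at x2
    rw [s31, s32, s33, zero_smul, add_zero] at x3
    set a := S.g.inner (γ t) (S.φ (γ t) (v 1 t)) (v 2 t)
    set b := S.g.inner (γ t) (S.φ (γ t) (v 1 t)) (v 3 t)
    set d := S.g.inner (γ t) (S.φ (γ t) (v 2 t)) (v 3 t)
    rw [x1] at n1
    rw [x2] at n2
    rw [x3] at n3
    rw [x2, x1] at n21
    rw [x3, x2] at n32
    simp [g11, g21, g22, g31, g32, g33, g12, g13, g23, hη2] at n1 n2 n3 n21 n32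
    -- `a b = 0` and `b d = 0`, so `b ≠ 0` would give `a = d = 0`, against `|φ v₂| = 1`
    have hb : b = 0 := by
      by_contra hb
      have ha : a = 0 := by tauto
      have hd : d = 0 := by tauto
      simp [ha, hd] at n2
    have hσ : κ 2 ^ 2 * ∑ α, S.η α (γ t) (v 3 t) * S.η α (γ t) (v 3 t)
        = κ 1 ^ 2 * ∑ α, c α ^ 2 := by
      rw [Finset.mul_sum, Finset.mul_sum]
      refine Finset.sum_congr rfl fun α _ => ?_
      linear_combination (κ 2 * S.η α (γ t) (v 3 t) + κ 1 * c α) * hη3 α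
    have hσ1 : ∑ α, c α * c α = ∑ α, c α ^ 2 := Finset.sum_congr rfl fun α _ => (sq _).symm
    rw [hσ1] at n1
    simp only [hb] at n1 n3 x1
    have hσD : (∑ α, c α ^ 2) * (κ 1 ^ 2 + κ 2 ^ 2) = κ 2 ^ 2 := by
      linear_combination -hσ + κ 2 ^ 2 * (n3 + n1 - n2)
    refine ⟨by rw [x1]; simp, ?_, hσD⟩
    linear_combination (κ 1 ^ 2 + κ 2 ^ 2) * n1 - hσD

omit [FiniteDimensional ℝ E] in
theorem continuousOn_inner_phi (S : FramedStructure E M s) (hγ : ContMDiffOn 𝓘(ℝ, ℝ) 𝓘(ℝ, E) ∞ γ J)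
    {V W : ∀ t : ℝ, TangentSpace 𝓘(ℝ, E) (γ t)} (hV : SmoothAlong γ J V) (hW : SmoothAlong γ J W) :
    ContinuousOn (fun t => S.g.inner (γ t) (S.φ (γ t) (V t)) (W t)) J := by
  intro t ht
  have h1 : ContMDiffWithinAt 𝓘(ℝ, ℝ) 𝓘(ℝ, E).tangent ∞
      (fun t => (⟨γ t, S.φ (γ t) (V t)⟩ : TangentBundle 𝓘(ℝ, E) M)) J t :=
    ContMDiffWithinAt.clm_bundle_apply
      ((S.φ_smooth.contMDiffAt (x := γ t)).comp_contMDiffWithinAt t (hγ t ht)) (hV t ht)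
  have h2 := ContMDiffWithinAt.clm_bundle_apply₂ (F₃ := ℝ) (E₃ := Bundle.Trivial M ℝ)
      ((S.g.contMDiff.contMDiffAt (x := γ t)).comp_contMDiffWithinAt t (hγ t ht)) h1 (hW t ht)
  exact ((contMDiffWithinAt_totalSpace).1 h2).2.continuousWithinAt

/-- The function `g(φ T, v₂)` takes only the values `± κ₁ / √(κ₁² + κ₂²)`, and it is continuous on an
interval, so its sign is constant. -/
theorem IsPhiHelix.isMagneticCurve (hS : S.IsCManifold) (hJ : IsOpen J) (hJc : J.OrdConnected)
    (h : S.IsPhiHelix γ J r v κ) (hr2 : 2 ≤ r) (hr3 : r ≤ 3) {c : Fin s → ℝ}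
    (hc : ∀ t ∈ J, ∀ α, S.η α (γ t) (v 1 t) = c α) :
    IsMagneticCurve S.g (S.magneticField (√(κ 1 ^ 2 + κ 2 ^ 2))) γ J ∨
      IsMagneticCurve S.g (S.magneticField (-√(κ 1 ^ 2 + κ 2 ^ 2))) γ J := by
  obtain rfl | ⟨t₀, ht₀⟩ := J.eq_empty_or_nonempty
  · exact .inl ⟨h.1.smooth, by simp⟩
  have hκ1 : 0 < κ 1 := h.1.curvature_pos t₀ ht₀ 1 le_rfl (by omega)
  have hD : 0 < κ 1 ^ 2 + κ 2 ^ 2 := by positivity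
  set k := √(κ 1 ^ 2 + κ 2 ^ 2)
  have hk : 0 < k := Real.sqrt_pos.2 hD
  have hk2 : k ^ 2 = κ 1 ^ 2 + κ 2 ^ 2 := Real.sq_sqrt hD.le
  have hcont := S.continuousOn_inner_phi h.1.smooth
    (h.1.frame_smooth 1 le_rfl h.1.one_le) (h.1.frame_smooth 2 one_le_two hr2)
  have hsign := hJc.isPreconnected.eq_or_eq_neg_of_sq_eq hcont
    (continuousOn_const (c := κ 1 / k))
    (fun t ht => by
      have h2 := (h.phi_velocity hS hJ hr2 hr3 hc ht).2.1
      rw [← hk2] at h2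
      simp only [Pi.pow_apply, div_pow]
      rw [eq_div_iff (by positivity), h2])
    (fun _ => by positivity)
  simp only [S.isMagneticCurve_iff hJ h.1]
  have hT : ∀ t ∈ J, S.g.covDeriv γ (v 1) t = κ 1 • v 2 t := by
    intro t ht
    rw [h.1.frenet t ht 1 le_rfl h.1.one_le, if_neg (by omega), if_pos (by omega), zero_add]
  rcases hsign with hs | hs
  · refine .inr fun t ht => ?_
    have ha := hs ht
    simp only at ha
    rw [hT t ht, (h.phi_velocity hS hJ hr2 hr3 hc ht).1, ha, smul_smul]
    congr 1
    field_simp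
  · refine .inl fun t ht => ?_
    have ha := hs ht
    simp only [Pi.neg_apply] at ha
    rw [hT t ht, (h.phi_velocity hS hJ hr2 hr3 hc ht).1, ha, smul_smul]
    congr 1
    field_simp

theorem IsPhiHelix.velocity_eq_sum (h : S.IsPhiHelix γ J 1 v κ) {t : ℝ} (ht : t ∈ J) :
    v 1 t = ∑ α, S.η α (γ t) (v 1 t) • S.ξ α (γ t) := by
  have h1 := S.φ_φ (γ t) (v 1 t)
  rw [h.phi_eq_zero ht, map_zero] at h1
  rw [eq_comm, neg_add_eq_zero] at h1
  exact h1

theorem IsPhiHelix.sum_eta_sq (h : S.IsPhiHelix γ J 1 v κ) {t : ℝ} (ht : t ∈ J) :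
    ∑ α, S.η α (γ t) (v 1 t) ^ 2 = 1 := by
  have h1 := S.g_φ_φ (γ t) (v 1 t) (v 1 t)
  rw [h.phi_eq_zero ht, h.1.orthonormal t ht 1 1 le_rfl le_rfl le_rfl le_rfl] at h1
  simp only [map_zero, if_true, ← sq] at h1
  linarith

theorem IsPhiHelix.exists_eta_eq_const_of_isMagneticCurve (hS : S.IsCManifold) (hJ : IsOpen J)
    (hJc : J.OrdConnected) (h : S.IsPhiHelix γ J r v κ) {q : ℝ}
    (hq : IsMagneticCurve S.g (S.magneticField q) γ J) (α : Fin s) :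
    ∃ c : ℝ, ∀ t ∈ J, S.η α (γ t) (v 1 t) = c := by
  rw [S.isMagneticCurve_iff hJ h.1] at hq
  have hd : ∀ t ∈ J, HasDerivAt (fun τ => S.η α (γ τ) (v 1 τ)) 0 t := by
    intro t ht
    have h1 := hasDerivAt_eta hS hJ h.1.smooth (h.1.frame_smooth 1 le_rfl h.1.one_le) ht α
    rwa [hq t ht, map_smul, S.η_φ, smul_zero] at h1
  exact hJ.exists_is_const_of_deriv_eq_zero hJc.isPreconnected
    (fun t ht => (hd t ht).differentiableAt.differentiableWithinAt) (fun t ht => (hd t ht).deriv)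

end

end FramedStructure

end

end CMfd

theorem theorem2 (n s : ℕ)
    (M : Type*) [TopologicalSpace M] [T2Space M] [SecondCountableTopology M]
    [ChartedSpace (EuclideanSpace ℝ (Fin (2 * n + s))) M]
    [IsManifold 𝓘(ℝ, EuclideanSpace ℝ (Fin (2 * n + s))) ∞ M]
    (S : CMfd.FramedStructure (EuclideanSpace ℝ (Fin (2 * n + s))) M s) (hS : S.IsCManifold)
    (J : Set ℝ) (hJo : IsOpen J) (hJc : J.OrdConnected) (hJn : J.Nonempty)
    (γ : ℝ → M) (r : ℕ) (hr : r ≤ 3)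
    (v : ℕ → ∀ t : ℝ, TangentSpace 𝓘(ℝ, EuclideanSpace ℝ (Fin (2 * n + s))) (γ t))
    (κ : ℕ → ℝ) (hγ : S.IsPhiHelix γ J r v κ) :
    (∀ θ : Fin s → ℝ, S.HasContactAngles γ J θ → ∑ α, Real.cos (θ α) ^ 2 = 1 →
      (IsMIntegralCurveOn (I := 𝓘(ℝ, EuclideanSpace ℝ (Fin (2 * n + s)))) γ
          (fun x => ∑ α, Real.cos (θ α) • S.ξ α x) J ∨
        IsMIntegralCurveOn (I := 𝓘(ℝ, EuclideanSpace ℝ (Fin (2 * n + s)))) γ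
          (fun x => -∑ α, Real.cos (θ α) • S.ξ α x) J) ∧
      ∀ q : ℝ, CMfd.IsNormalMagneticCurve S.g (S.magneticField q) γ J) ∧
    (S.IsLegendre γ J →
      CMfd.IsCircle S.g γ J (κ 1) ∧
      (CMfd.IsNormalMagneticCurve S.g (S.magneticField (κ 1)) γ J ∨
        CMfd.IsNormalMagneticCurve S.g (S.magneticField (-κ 1)) γ J)) ∧
    (∀ θ : Fin s → ℝ, S.HasContactAngles γ J θ → 2 ≤ r →
      ∑ α, Real.cos (θ α) ^ 2 = κ 2 ^ 2 / (κ 1 ^ 2 + κ 2 ^ 2) →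
      CMfd.IsNormalMagneticCurve S.g (S.magneticField (√(κ 1 ^ 2 + κ 2 ^ 2))) γ J ∨
        CMfd.IsNormalMagneticCurve S.g (S.magneticField (-√(κ 1 ^ 2 + κ 2 ^ 2))) γ J) ∧
    ((¬∃ θ : Fin s → ℝ, S.HasContactAngles γ J θ ∧
        (∑ α, Real.cos (θ α) ^ 2 = 1 ∨ (∀ α, Real.cos (θ α) = 0) ∨
          (2 ≤ r ∧ ∑ α, Real.cos (θ α) ^ 2 = κ 2 ^ 2 / (κ 1 ^ 2 + κ 2 ^ 2)))) →
      ∀ q : ℝ, ¬CMfd.IsMagneticCurve S.g (S.magneticField q) γ J) := by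
  have hT := hγ.1.frame_one
  obtain ⟨t₀, ht₀⟩ := hJn
  have hr1 := hγ.1.one_le
  have hunit : ∀ t ∈ J, S.g.inner (γ t) (CMfd.velocity γ t) (CMfd.velocity γ t) = 1 := by
    intro t ht
    rw [← hT t ht, hγ.1.orthonormal t ht 1 1 le_rfl hr1 le_rfl hr1, if_pos rfl]
  have hcases : r = 1 ∨ 2 ≤ r := by omega
  refine ⟨fun θ hθ hsum => ?_, fun hL => ?_, fun θ hθ hr2 _ => ?_, fun hno q hq => hno ?_⟩
  · have hc : ∀ t ∈ J, ∀ α, S.η α (γ t) (v 1 t) = Real.cos (θ α) := fun t ht α => by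
      rw [hT t ht, hθ t ht α]
    obtain rfl | hr2 := hcases
    · constructor
      · left
        intro t ht
        have h0 := (hγ.1.smooth.contMDiffAt (hJo.mem_nhds ht)).mdifferentiableAt (by simp)
        have h1 := h0.hasMFDerivAt.hasMFDerivWithinAt (s := J)
        have h2 := hγ.velocity_eq_sum ht
        simp only [hc t ht] at h2
        rw [hT t ht] at h2
        refine h1.congr_mfderiv (Eq.symm ?_)
        refine ContinuousLinearMap.ext fun (a : ℝ) => ?_
        have h3 := (mfderiv 𝓘(ℝ, ℝ) 𝓘(ℝ, EuclideanSpace ℝ (Fin (2 * n + s))) γ t).map_smul a (1 : ℝ)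
        refine Eq.trans ?_ (h3.symm.trans (congrArg _ (mul_one a)))
        exact congrArg (a • ·) h2.symm
      · refine fun q => ⟨(S.isMagneticCurve_iff hJo hγ.1 q).2 fun t ht => ?_, hunit⟩
        rw [hγ.phi_eq_zero ht, hγ.1.frenet t ht 1 le_rfl le_rfl]
        simp
    · -- the sum is `κ₂² / (κ₁² + κ₂²) < 1`
      have h1 := (hγ.phi_velocity hS hJo hr2 hr hc ht₀).2.2
      have h2 : 0 < κ 1 := hγ.1.curvature_pos t₀ ht₀ 1 le_rfl (by omega)
      rw [hsum] at h1
      nlinarith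
  · have hc : ∀ t ∈ J, ∀ α, S.η α (γ t) (v 1 t) = 0 := fun t ht α => by rw [hT t ht, hL t ht α]
    obtain rfl | hr2 := hcases
    · simpa [hc t₀ ht₀] using hγ.sum_eta_sq ht₀
    · have h1 := (hγ.phi_velocity hS hJo hr2 hr hc ht₀).2.2
      have h2 : 0 < κ 1 := hγ.1.curvature_pos t₀ ht₀ 1 le_rfl (by omega)
      have hκ2 : κ 2 = 0 := by simpa using h1.symm
      obtain rfl | rfl : r = 2 ∨ r = 3 := by omega
      · have h3 := hγ.isMagneticCurve hS hJo hJc le_rfl hr hc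
        rw [hκ2, zero_pow two_ne_zero, add_zero, Real.sqrt_sq h2.le] at h3
        refine ⟨⟨h2, v, hγ.1.one_le, hγ.1.smooth, hγ.1.frame_smooth, hγ.1.frame_one,
          hγ.1.orthonormal, fun t ht i hi hi2 => ?_, fun t ht i hi => if_neg (by omega),
          fun t ht i hi hi2 => ?_⟩, h3.imp (⟨·, hunit⟩) (⟨·, hunit⟩)⟩
        · rwa [if_pos (by omega)]
        · rw [hγ.1.frenet t ht i hi hi2]
          obtain rfl | rfl : i = 1 ∨ i = 2 := by omega
          all_goals simp
      · exact absurd hκ2 (hγ.1.curvature_pos t₀ ht₀ 2 one_le_two (by omega)).ne'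
  · have hc : ∀ t ∈ J, ∀ α, S.η α (γ t) (v 1 t) = Real.cos (θ α) := fun t ht α => by
      rw [hT t ht, hθ t ht α]
    exact (hγ.isMagneticCurve hS hJo hJc hr2 hr hc).imp (⟨·, hunit⟩) (⟨·, hunit⟩)
  · choose c hc using fun α => hγ.exists_eta_eq_const_of_isMagneticCurve hS hJo hJc hq α
    -- `|η^α(T)| ≤ |T| = 1`, so `η^α(T)` is the cosine of some angle
    have hcos : ∀ α, Real.cos (Real.arccos (c α)) = c α := by
      intro α
      have h1 := S.sq_eta_le (γ t₀) (v 1 t₀) α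
      rw [hc α t₀ ht₀, hT t₀ ht₀, hunit t₀ ht₀, sq_le_one_iff_abs_le_one, abs_le] at h1
      exact Real.cos_arccos h1.1 h1.2
    refine ⟨fun α => Real.arccos (c α), fun t ht α => ?_, ?_⟩
    · rw [hcos, ← hT t ht, hc α t ht]
    · simp only [hcos]
      obtain rfl | hr2 := hcases
      · left
        simpa only [hc _ t₀ ht₀] using hγ.sum_eta_sq ht₀
      · right; right
        have h1 := (hγ.phi_velocity hS hJo hr2 hr (fun t ht α => hc α t ht) ht₀).2.2
        have h2 : 0 < κ 1 := hγ.1.curvature_pos t₀ ht₀ 1 le_rfl (by omega)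
        exact ⟨hr2, (eq_div_iff (by positivity)).2 h1⟩
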